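/- Let $\mathbb D=\{z\in\mathbb C:|z|<1\}$. Let $S_H^O$ be the class of complex-valued, harmonic, sense-preserving, univalent functions $f$ in $\mathbb D$ with $f(0)=0$, $f_z(0)=1$, $f_{\bar z}(0)=0$, and let $K_H^O\subset S_H^O$ be the subclass of those mapping $\mathbb D$ onto a convex domain. For $F=H+\overline G$ and $f=h+\overline g$, where $H,G,h,g$ are analytic in $\mathbb D$ and vanish at $0$, write $F*f=H*h+\overline{G*g}$, where $H*h$ and $G*g$ are Hadamard products of power series at $0$. Let $$f_0(z)=\frac{z-\frac12z^2}{(1-z)^2}-\overline{\left(\frac{\frac12z^2}{(1-z)^2}\right)}.$$ Theorem. Let $-1<a<1$ and let $h,g$ be analytic in $\mathbb D$ with $h(0)=g(0)=0$. Suppose that $f=h+\overline g$ is sense-preserving and univalent in $\mathbb D$ and maps $\mathbb D$ onto a convex domain, that $h(z)+g(z)=\frac{z}{1-z}$ in $\mathbb D$, and that $f$ has dilatation $\omega(z)=\frac{g'(z)}{h'(z)}=\frac{z+a}{1+az}$ in $\mathbb D$. Then $(1+a)\,(f_0*f)\in S_H^O$, and $f_0*f$ is convex in the direction of the real axis, that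 is, every horizontal line meets $(f_0*f)(\mathbb D)$ in a convex (possibly empty) set. In particular, if $f\in K_H^O$, then $f_0*f\in S_H^O$. -/

import Mathlib

open ComplexConjugate

noncomputable section

/-- The open unit disk. -/
def unitDisk : Set ℂ := Metric.ball (0 : ℂ) 1

/-- The Wirtinger derivative `∂f/∂z = (f_x - i f_y) / 2`. -/
def wirtingerDz (f : ℂ → ℂ) (z : ℂ) : ℂ :=
  (fderiv ℝ f z 1 - Complex.I * fderiv ℝ f z Complex.I) / 2

/-- The Wirtinger derivative `∂f/∂z̄ = (f_x + i f_y) / 2`. -/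
def wirtingerDzbar (f : ℂ → ℂ) (z : ℂ) : ℂ :=
  (fderiv ℝ f z 1 + Complex.I * fderiv ℝ f z Complex.I) / 2

/-- `f` is a complex-valued, harmonic, sense-preserving, univalent function in the unit disk
with `f 0 = 0`; nothing is required of its first order derivatives at the origin.
Sense-preserving means that the Jacobian `|f_z|² - |f_z̄|²` is positive. -/
structure IsUnivalentHarmonic (f : ℂ → ℂ) : Prop where
  harmonic : InnerProductSpace.HarmonicOnNhd f unitDisk
  sensePreserving : ∀ z ∈ unitDisk, ‖wirtingerDzbar f z‖ < ‖wirtingerDz f z‖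
  univalent : Set.InjOn f unitDisk
  map_zero : f 0 = 0

/-- The class `S_H^O`: in addition `f_z(0) = 1` and `f_z̄(0) = 0`. -/
structure IsSHO (f : ℂ → ℂ) : Prop extends IsUnivalentHarmonic f where
  dz_zero : wirtingerDz f 0 = 1
  dzbar_zero : wirtingerDzbar f 0 = 0

/-- The class `K_H^O`: the functions in `S_H^O` that map the disk onto a convex domain. -/
structure IsKHO (f : ℂ → ℂ) : Prop extends IsSHO f where
  convex_image : Convex ℝ (f '' unitDisk)

/-- Every horizontal line meets `S` in a (possibly empty) convex set. -/
def ConvexInRealDirection (S : Set ℂ) : Prop :=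
  ∀ w₁ ∈ S, ∀ w₂ ∈ S, w₁.im = w₂.im → segment ℝ w₁ w₂ ⊆ S

/-- The harmonic function `h + conj g`. -/
def harmonicMap (h g : ℂ → ℂ) (z : ℂ) : ℂ := h z + conj (g z)

/-- The dilatation `ω = g' / h'` of `h + conj g`. -/
def dilatation (h g : ℂ → ℂ) (z : ℂ) : ℂ := deriv g z / deriv h z

/-- The `n`-th Taylor coefficient at the origin. -/
def taylorCoeffZero (F : ℂ → ℂ) (n : ℕ) : ℂ := iteratedDeriv n F 0 / (n.factorial : ℂ)

/-- The convolution (Hadamard product) `∑ aₙ Aₙ zⁿ` of two analytic functions. -/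
def analyticConvolution (F G : ℂ → ℂ) (z : ℂ) : ℂ :=
  ∑' n : ℕ, taylorCoeffZero F n * taylorCoeffZero G n * z ^ n

/-- The harmonic convolution `(h + conj g) * (H + conj G) = h * H + conj (g * G)`. -/
def harmonicConvolution (h g H G : ℂ → ℂ) : ℂ → ℂ :=
  harmonicMap (analyticConvolution h H) (analyticConvolution g G)

/-- The analytic part of the canonical right half-plane mapping `f₀ = h₀ + conj g₀`. -/
def canonH (z : ℂ) : ℂ := (z - z ^ 2 / 2) / (1 - z) ^ 2

/-- The co-analytic part of the canonical right half-plane mapping `f₀ = h₀ + conj g₀`. -/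
def canonG (z : ℂ) : ℂ := -(z ^ 2 / 2) / (1 - z) ^ 2

end

/-! Convolution with `canonH` and `canonG` acts by `F ↦ (F ± zF')/2`, so `f₀ * f = P + conj Q` on
the disk with `P = (h + zh')/2` and `Q = (g - zg')/2`. The sum and dilatation conditions determine
`h'` and `g'` (`deriv_of_shear`), and `|Q'| < |P'|` reduces to a comparison of a real quadratic with
its reciprocal (`norm_quadratic_lt`).

For univalence and horizontal convexity, the real part is that of `P + Q` and the imaginary part
that of `P - Q`. With `ζ = (1+z)/(1-z)` and `c = (1-a)/(1+a)`, `P + Q = ((1 + c/2)ζ - (c/2)/ζ -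
1)/4` and `P - Q = (2c log ζ + ζ² - 1)/8`. In polar coordinates of the half-plane these give
`shearRe` and `shearIm`. Each level set of `shearIm` is empty or a single curve along which
`shearRe` is strictly monotone (`exists_level_param`). Hence each horizontal line meets the image in
an interval, covered once. -/

/-! ### Level curves of the sheared map in polar coordinates. -/

/-- The horizontal coordinate of the sheared map, up to an affine change, in polar coordinates
`ζ = ρ e^{iq}` of the right half-plane. -/
noncomputable def shearRe (c ρ q : ℝ) : ℝ := Real.cos q * ((1 + c / 2) * ρ - c / 2 / ρ)

/-- The vertical coordinate of the sheared map, up to scaling, in polar coordinates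
`ζ = ρ e^{iq}` of the right half-plane. -/
noncomputable def shearIm (c ρ q : ℝ) : ℝ := 2 * c * q + ρ ^ 2 * Real.sin (2 * q)

lemma shearRe_neg (c ρ q : ℝ) : shearRe c ρ (-q) = shearRe c ρ q := by
  simp [shearRe]

lemma shearIm_neg (c ρ q : ℝ) : shearIm c ρ (-q) = -shearIm c ρ q := by
  simp only [shearIm, mul_neg, Real.sin_neg]; ring

lemma shearIm_pos {c ρ q : ℝ} (hc : 0 < c) (hρ : 0 < ρ) (hq : 0 < q) (hq' : q < Real.pi / 2) :
    0 < shearIm c ρ q := by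
  have : 0 < Real.sin (2 * q) := Real.sin_pos_of_pos_of_lt_pi (by linarith) (by linarith)
  unfold shearIm; positivity

/-- The modulus of the point with argument `q` on the level curve `shearIm c ρ q = k`. -/
noncomputable def levelRadius (c k q : ℝ) : ℝ := √((k - 2 * c * q) / Real.sin (2 * q))

/-- With `s = ρ²` and `C = cos 2q` this is the Jacobian of (`shearRe`, `shearIm`) in `(ρ, q)`
divided by `2 cos q`. Clearing the denominator leaves a sum of nonnegative terms. -/
lemma jacobian_pos {c s C : ℝ} (hc : 0 < c) (hs : 0 < s) (hC : -1 ≤ C) :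
    0 < (1 - C) * ((1 + c / 2) * s - c / 2) + (1 + c / 2 / s) * (c + s * C) +
      c / 2 * (c + s * C) := by
  have e : (1 - C) * ((1 + c / 2) * s - c / 2) + (1 + c / 2 / s) * (c + s * C) +
      c / 2 * (c + s * C) =
      ((s - c) ^ 2 + s ^ 2 + c * s ^ 2 + c ^ 2 * s + c * s + 2 * c * s * (1 + C)) / (2 * s) := by
    field_simp; ring
  rw [e]
  have : 0 ≤ 1 + C := by linarith
  positivity

lemma levelRadius_pos {c k q : ℝ} (hq : 0 < q) (hq' : q < Real.pi / 2) (hk : 2 * c * q < k) :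
    0 < levelRadius c k q := by
  have : 0 < Real.sin (2 * q) := Real.sin_pos_of_pos_of_lt_pi (by linarith) (by linarith)
  exact Real.sqrt_pos.2 (div_pos (by linarith) this)

lemma shearIm_levelRadius {c k q : ℝ} (hq : 0 < q) (hq' : q < Real.pi / 2) (hk : 2 * c * q < k) :
    shearIm c (levelRadius c k q) q = k := by
  have hs : 0 < Real.sin (2 * q) := Real.sin_pos_of_pos_of_lt_pi (by linarith) (by linarith)
  rw [shearIm, levelRadius, Real.sq_sqrt (div_pos (by linarith) hs).le,
    div_mul_cancel₀ _ hs.ne']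
  ring

lemma levelRadius_shearIm {c ρ q : ℝ} (hρ : 0 < ρ) (hq : 0 < q) (hq' : q < Real.pi / 2) :
    levelRadius c (shearIm c ρ q) q = ρ := by
  have hs : 0 < Real.sin (2 * q) := Real.sin_pos_of_pos_of_lt_pi (by linarith) (by linarith)
  rw [levelRadius, shearIm, add_sub_cancel_left, mul_div_cancel_right₀ _ hs.ne',
    Real.sqrt_sq hρ.le]

lemma exists_hasDerivAt_shearRe_levelRadius {c k q : ℝ} (hc : 0 < c) (hq : 0 < q)
    (hq' : q < Real.pi / 2) (hk : 2 * c * q < k) :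
    ∃ d < 0, HasDerivAt (fun q => shearRe c (levelRadius c k q) q) d q := by
  have hs : 0 < Real.sin (2 * q) := Real.sin_pos_of_pos_of_lt_pi (by linarith) (by linarith)
  have hsin : 0 < Real.sin q := Real.sin_pos_of_pos_of_lt_pi hq (by linarith)
  have hcos : 0 < Real.cos q := Real.cos_pos_of_mem_Ioo ⟨by linarith, hq'⟩
  have hr := levelRadius_pos hq hq' hk
  have hr2 : levelRadius c k q ^ 2 = (k - 2 * c * q) / Real.sin (2 * q) :=
    Real.sq_sqrt (div_pos (by linarith) hs).le
  have hk' : k - 2 * c * q = levelRadius c k q ^ 2 * Real.sin (2 * q) := by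
    rw [hr2, div_mul_cancel₀ _ hs.ne']
  set r := levelRadius c k q with hrdef
  have h2 : HasDerivAt (fun q : ℝ => 2 * q) 2 q := by simpa using (hasDerivAt_id q).const_mul 2
  have hnum : HasDerivAt (fun q : ℝ => k - 2 * c * q) (-(2 * c)) q := by
    simpa using ((hasDerivAt_id q).const_mul (2 * c)).const_sub k
  have hrad : HasDerivAt (levelRadius c k)
      (-(c + r ^ 2 * Real.cos (2 * q)) / (r * Real.sin (2 * q))) q := by
    have := (hnum.div h2.sin hs.ne').sqrt (div_pos (by linarith) hs).ne'
    refine this.congr_deriv ?_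
    change _ / (2 * r) = _
    rw [hk']
    field_simp
    ring
  refine ⟨_, ?_, (Real.hasDerivAt_cos q).mul ((hrad.const_mul (1 + c / 2)).sub
    ((hasDerivAt_const q (c / 2)).div hrad hr.ne'))⟩
  rw [← hrdef]
  -- Once `k` is eliminated through `hk'`, the derivative is minus this quantity divided by `2 r sin
  -- q`.
  have hJ := jacobian_pos (C := Real.cos (2 * q)) hc (pow_pos hr 2) (Real.neg_one_le_cos _)
  have e1 : 1 - Real.cos (2 * q) = 2 * Real.sin q ^ 2 := by
    rw [Real.cos_two_mul, Real.cos_sq']; ring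
  rw [e1] at hJ
  have key := div_pos hJ (show 0 < 2 * r * Real.sin q by positivity)
  rw [← neg_pos]
  refine lt_of_lt_of_eq key ?_
  rw [Real.sin_two_mul]
  field_simp
  ring

/-- Every level set of `shearIm` in the half-plane is parametrized by a connected set of reals,
in such a way that `shearRe` is continuous and injective in the parameter. -/
lemma exists_level_param {c : ℝ} (hc : 0 < c) (k : ℝ) :
    ∃ (I : Set ℝ) (ρ q : ℝ → ℝ), IsPreconnected I ∧
      (∀ t ∈ I, 0 < ρ t ∧ |q t| < Real.pi / 2 ∧ shearIm c (ρ t) (q t) = k) ∧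
      (∀ r s, 0 < r → |s| < Real.pi / 2 → shearIm c r s = k → ∃ t ∈ I, ρ t = r ∧ q t = s) ∧
      ContinuousOn (fun t => shearRe c (ρ t) (q t)) I ∧
      Set.InjOn (fun t => shearRe c (ρ t) (q t)) I := by
  -- The reflection `q ↦ -q` fixes `shearRe` and negates `shearIm`, so `k < 0` follows from `k > 0`.
  have pos : ∀ k, 0 < k → ∃ (I : Set ℝ) (ρ q : ℝ → ℝ), IsPreconnected I ∧
      (∀ t ∈ I, 0 < ρ t ∧ |q t| < Real.pi / 2 ∧ shearIm c (ρ t) (q t) = k) ∧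
      (∀ r s, 0 < r → |s| < Real.pi / 2 → shearIm c r s = k → ∃ t ∈ I, ρ t = r ∧ q t = s) ∧
      ContinuousOn (fun t => shearRe c (ρ t) (q t)) I ∧
      Set.InjOn (fun t => shearRe c (ρ t) (q t)) I := by
    intro k hk
    have hI : ∀ t ∈ Set.Ioo 0 (min (Real.pi / 2) (k / (2 * c))),
        0 < t ∧ t < Real.pi / 2 ∧ 2 * c * t < k := fun t ht => by
      obtain ⟨h0, h1⟩ := ht
      obtain ⟨h1, h2⟩ := lt_min_iff.1 h1
      rw [lt_div_iff₀ (by positivity)] at h2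
      exact ⟨h0, h1, by linarith⟩
    have hcont : ContinuousOn (fun t => shearRe c (levelRadius c k t) t)
        (Set.Ioo 0 (min (Real.pi / 2) (k / (2 * c)))) := fun t ht => by
      obtain ⟨h0, h1, h2⟩ := hI t ht
      obtain ⟨d, -, hd⟩ := exists_hasDerivAt_shearRe_levelRadius hc h0 h1 h2
      exact hd.continuousAt.continuousWithinAt
    refine ⟨Set.Ioo 0 (min (Real.pi / 2) (k / (2 * c))), levelRadius c k, id,
      isPreconnected_Ioo, ?_, ?_, hcont, ?_⟩
    · intro t ht
      obtain ⟨h0, h1, h2⟩ := hI t ht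
      exact ⟨levelRadius_pos h0 h1 h2, by rwa [id, abs_of_pos h0], shearIm_levelRadius h0 h1 h2⟩
    · intro r s hr hs hrs
      obtain ⟨hs1, hs2⟩ := abs_lt.1 hs
      have hs0 : 0 < s := by
        rcases lt_trichotomy s 0 with h | h | h
        · have := shearIm_pos hc hr (neg_pos.2 h) (by linarith)
          rw [shearIm_neg] at this
          linarith
        · simp [shearIm, h] at hrs
          linarith
        · exact h
      refine ⟨s, ⟨hs0, lt_min hs2 ?_⟩, ?_, rfl⟩
      · rw [lt_div_iff₀ (by positivity), ← hrs, shearIm]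
        have : 0 < Real.sin (2 * s) := Real.sin_pos_of_pos_of_lt_pi (by linarith) (by linarith)
        have : 0 < r ^ 2 * Real.sin (2 * s) := by positivity
        linarith
      · rw [← hrs, levelRadius_shearIm hr hs0 hs2]
    · refine (strictAntiOn_of_deriv_neg (convex_Ioo _ _) hcont fun t ht => ?_).injOn
      rw [interior_Ioo] at ht
      obtain ⟨h0, h1, h2⟩ := hI t ht
      obtain ⟨d, hd0, hd⟩ := exists_hasDerivAt_shearRe_levelRadius hc h0 h1 h2
      exact hd.deriv.trans_lt hd0
  rcases lt_trichotomy k 0 with hk | rfl | hk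
  · obtain ⟨I, ρ, q, hI, h1, h2, h3, h4⟩ := pos (-k) (neg_pos.2 hk)
    refine ⟨I, ρ, fun t => -q t, hI, ?_, ?_, ?_, ?_⟩
    · intro t ht
      obtain ⟨p1, p2, p3⟩ := h1 t ht
      exact ⟨p1, by rwa [abs_neg], by rw [shearIm_neg, p3, neg_neg]⟩
    · intro r s hr hs hrs
      obtain ⟨t, ht, e1, e2⟩ := h2 r (-s) hr (by rwa [abs_neg]) (by rw [shearIm_neg, hrs])
      exact ⟨t, ht, e1, by simp [e2]⟩
    · simpa only [shearRe_neg] using h3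
    · simpa only [shearRe_neg] using h4
  -- The level `k = 0` is the positive real axis, where the modulus replaces the argument as
  -- parameter.
  · refine ⟨Set.Ioi 0, id, fun _ => 0, isPreconnected_Ioi, ?_, ?_, ?_, ?_⟩
    · intro t ht
      exact ⟨ht, by simp [Real.pi_pos], by simp [shearIm]⟩
    · intro r s hr hs hrs
      obtain ⟨hs1, hs2⟩ := abs_lt.1 hs
      refine ⟨r, hr, rfl, ?_⟩
      rcases lt_trichotomy s 0 with h | h | h
      · have := shearIm_pos hc hr (neg_pos.2 h) (by linarith)
        rw [shearIm_neg] at this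
        linarith
      · exact h.symm
      · have := shearIm_pos hc hr h hs2
        linarith
    · simp only [shearRe, id]
      have : ∀ t ∈ Set.Ioi (0 : ℝ), t ≠ 0 := fun t ht => (Set.mem_Ioi.1 ht).ne'
      fun_prop (disch := assumption)
    · refine StrictMonoOn.injOn fun s hs t ht hst => ?_
      simp only [shearRe, id, Real.cos_zero, one_mul]
      have hs' : 0 < s := hs
      have : c / 2 / t < c / 2 / s := by gcongr
      have : (1 + c / 2) * s < (1 + c / 2) * t := by gcongr
      linarith
  · exact pos k hk

/-- A plane map which in polar coordinates of the right half-plane is the sheared map is injective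
and has an image convex in the direction of the real axis. -/
lemma injOn_and_convexInRealDirection {c : ℝ} (hc : 0 < c) {α : Type*} {S : Set α} {F : α → ℂ}
    {r s : α → ℝ} (hr : ∀ z ∈ S, 0 < r z) (hs : ∀ z ∈ S, |s z| < Real.pi / 2)
    (hinj : ∀ z ∈ S, ∀ w ∈ S, r z = r w → s z = s w → z = w)
    (hsurj : ∀ ρ q : ℝ, 0 < ρ → |q| < Real.pi / 2 → ∃ z ∈ S, r z = ρ ∧ s z = q)
    (hre : ∀ z ∈ S, (F z).re = (shearRe c (r z) (s z) - 1) / 4)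
    (him : ∀ z ∈ S, (F z).im = shearIm c (r z) (s z) / 8) :
    Set.InjOn F S ∧ ConvexInRealDirection (F '' S) := by
  constructor
  · intro z hz w hw hzw
    obtain ⟨I, ρ, q, -, -, h2, -, h4⟩ := exists_level_param hc (shearIm c (r z) (s z))
    have e1 : shearIm c (r w) (s w) = shearIm c (r z) (s z) := by
      have := him z hz
      rw [hzw, him w hw] at this
      linarith
    have e2 : shearRe c (r w) (s w) = shearRe c (r z) (s z) := by
      have := hre z hz
      rw [hzw, hre w hw] at this
      linarith
    obtain ⟨t, ht, t1, t2⟩ := h2 _ _ (hr z hz) (hs z hz) rfl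
    obtain ⟨u, hu, u1, u2⟩ := h2 _ _ (hr w hw) (hs w hw) e1
    have : t = u := h4 ht hu (by simp only [t1, t2, u1, u2, e2])
    subst this
    exact hinj z hz w hw (t1.symm.trans u1) (t2.symm.trans u2)
  · rintro _ ⟨z, hz, rfl⟩ _ ⟨w, hw, rfl⟩ hzw p hp
    obtain ⟨I, ρ, q, hI, h1, h2, h3, -⟩ := exists_level_param hc (shearIm c (r z) (s z))
    have e1 : shearIm c (r w) (s w) = shearIm c (r z) (s z) := by
      rw [him z hz, him w hw] at hzw
      linarith
    obtain ⟨t, ht, t1, t2⟩ := h2 _ _ (hr z hz) (hs z hz) rfl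
    obtain ⟨u, hu, u1, u2⟩ := h2 _ _ (hr w hw) (hs w hw) e1
    -- The values of `shearRe` on the level curve form an interval, so they include the one required
    -- by `p`.
    have hoc : Convex ℝ _ := (hI.image _ h3).ordConnected.convex
    have hpre : 4 * p.re + 1 ∈ (fun t => shearRe c (ρ t) (q t)) '' I := by
      obtain ⟨x, y, hx, hy, hxy, rfl⟩ := hp
      have := hoc (Set.mem_image_of_mem _ ht) (Set.mem_image_of_mem _ hu) hx hy hxy
      convert this using 1
      simp only [t1, t2, u1, u2, Complex.add_re, Complex.real_smul, Complex.re_ofReal_mul,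
        hre z hz, hre w hw, smul_eq_mul]
      linear_combination (-1) * hxy
    have hpim : p.im = (F z).im := by
      obtain ⟨x, y, hx, hy, hxy, rfl⟩ := hp
      simp only [Complex.add_im, Complex.real_smul, Complex.im_ofReal_mul, ← hzw]
      linear_combination (F z).im * hxy
    obtain ⟨v, hv, hvp⟩ := hpre
    obtain ⟨p1, p2, p3⟩ := h1 v hv
    obtain ⟨x, hx, x1, x2⟩ := hsurj _ _ p1 p2
    refine ⟨x, hx, Complex.ext ?_ ?_⟩
    · rw [hre x hx, x1, x2]
      simp only at hvp
      rw [hvp]; ring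
    · rw [him x hx, x1, x2, p3, hpim, him z hz]

/-! ### Taylor coefficients and convolution with `f₀`. -/

lemma mem_unitDisk {z : ℂ} : z ∈ unitDisk ↔ ‖z‖ < 1 := mem_ball_zero_iff

lemma isOpen_unitDisk : IsOpen unitDisk := Metric.isOpen_ball

lemma taylorCoeffZero_eq {F : ℂ → ℂ} {c : ℕ → ℂ}
    (h : ∀ z ∈ unitDisk, HasSum (fun n => c n * z ^ n) (F z)) (n : ℕ) :
    taylorCoeffZero F n = c n := by
  have h1 : HasFPowerSeriesAt F (FormalMultilinearSeries.ofScalars ℂ c) 0 := by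
    rw [hasFPowerSeriesAt_iff']
    filter_upwards [isOpen_unitDisk.mem_nhds (mem_unitDisk.2 (by simp : ‖(0 : ℂ)‖ < 1))]
      with z hz
    simpa [mul_comm] using h z hz
  have h2 := h1.eq_formalMultilinearSeries h1.analyticAt.hasFPowerSeriesAt
  have h3 := congrArg (fun p => FormalMultilinearSeries.coeff p n) h2
  simpa [taylorCoeffZero] using h3.symm

lemma hasSum_taylorCoeffZero {F : ℂ → ℂ} (hF : DifferentiableOn ℂ F unitDisk) {z : ℂ}
    (hz : z ∈ unitDisk) : HasSum (fun n => taylorCoeffZero F n * z ^ n) (F z) := by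
  refine (Complex.hasSum_taylorSeries_on_ball hF hz).congr_fun fun n => ?_
  simp only [taylorCoeffZero, sub_zero, smul_eq_mul]
  ring

lemma hasSum_mul_taylorCoeffZero {F : ℂ → ℂ} (hF : DifferentiableOn ℂ F unitDisk) {z : ℂ}
    (hz : z ∈ unitDisk) :
    HasSum (fun n : ℕ => n * (taylorCoeffZero F n * z ^ n)) (z * deriv F z) := by
  have h := (hasSum_taylorCoeffZero (hF.deriv isOpen_unitDisk) hz).mul_left z
  refine (hasSum_nat_add_iff' 1).1 ?_
  simp only [Finset.range_one, Finset.sum_singleton, Nat.cast_zero, zero_mul, sub_zero]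
  refine h.congr_fun fun n => ?_
  simp only [taylorCoeffZero, iteratedDeriv_succ', Nat.factorial_succ, Nat.cast_mul]
  have : ((n + 1 : ℕ) : ℂ) ≠ 0 := Nat.cast_ne_zero.2 n.succ_ne_zero
  have := Nat.cast_ne_zero (R := ℂ).2 n.factorial_ne_zero
  field_simp
  ring

lemma one_sub_ne_zero {z : ℂ} (hz : z ∈ unitDisk) : 1 - z ≠ 0 := by
  intro h
  rw [← sub_eq_zero.1 h, mem_unitDisk] at hz
  simp at hz

lemma one_add_ne_zero {z : ℂ} (hz : z ∈ unitDisk) : 1 + z ≠ 0 := by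
  intro h
  rw [eq_neg_of_add_eq_zero_right h, mem_unitDisk] at hz
  simp at hz

/-- `canonH` is half the sum of `1/(1-z)` and `z/(1-z)²`, less the constant `1/2`; hence the
correction at `n = 0`. -/
lemma taylorCoeffZero_canonH (n : ℕ) :
    taylorCoeffZero canonH n = (1 + n) / 2 - if n = 0 then 1 / 2 else 0 := by
  refine taylorCoeffZero_eq (c := fun n : ℕ => (1 + (n : ℂ)) / 2 - if n = 0 then 1 / 2 else 0)
    (fun z hz => ?_) n
  have h := (((hasSum_geometric_of_norm_lt_one (mem_unitDisk.1 hz)).add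
    (hasSum_coe_mul_geometric_of_norm_lt_one (mem_unitDisk.1 hz))).div_const 2).sub
    (hasSum_ite_eq 0 (1 / 2 : ℂ))
  have e : canonH z = ((1 - z)⁻¹ + z / (1 - z) ^ 2) / 2 - 1 / 2 := by
    have := one_sub_ne_zero hz
    rw [canonH.eq_def]
    field_simp
    ring
  rw [e]
  refine h.congr_fun fun n => ?_
  split_ifs with hn
  · simp [hn]
  · ring

lemma taylorCoeffZero_canonG (n : ℕ) :
    taylorCoeffZero canonG n = (1 - n) / 2 - if n = 0 then 1 / 2 else 0 := by
  refine taylorCoeffZero_eq (c := fun n : ℕ => (1 - (n : ℂ)) / 2 - if n = 0 then 1 / 2 else 0)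
    (fun z hz => ?_) n
  have h := (((hasSum_geometric_of_norm_lt_one (mem_unitDisk.1 hz)).sub
    (hasSum_coe_mul_geometric_of_norm_lt_one (mem_unitDisk.1 hz))).div_const 2).sub
    (hasSum_ite_eq 0 (1 / 2 : ℂ))
  have e : canonG z = ((1 - z)⁻¹ - z / (1 - z) ^ 2) / 2 - 1 / 2 := by
    have := one_sub_ne_zero hz
    rw [canonG.eq_def]
    field_simp
    ring
  rw [e]
  refine h.congr_fun fun n => ?_
  split_ifs with hn
  · simp [hn]
  · ring

lemma analyticConvolution_canonH {F : ℂ → ℂ} (hF : DifferentiableOn ℂ F unitDisk) (h0 : F 0 = 0)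
    {z : ℂ} (hz : z ∈ unitDisk) :
    analyticConvolution canonH F z = (F z + z * deriv F z) / 2 := by
  refine HasSum.tsum_eq ?_
  refine (((hasSum_taylorCoeffZero hF hz).add
    (hasSum_mul_taylorCoeffZero hF hz)).div_const 2).congr_fun fun n => ?_
  rw [taylorCoeffZero_canonH]
  split_ifs with hn
  · simp [hn, taylorCoeffZero, h0]
  · ring

lemma analyticConvolution_canonG {F : ℂ → ℂ} (hF : DifferentiableOn ℂ F unitDisk) (h0 : F 0 = 0)
    {z : ℂ} (hz : z ∈ unitDisk) :
    analyticConvolution canonG F z = (F z - z * deriv F z) / 2 := by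
  refine HasSum.tsum_eq ?_
  refine (((hasSum_taylorCoeffZero hF hz).sub
    (hasSum_mul_taylorCoeffZero hF hz)).div_const 2).congr_fun fun n => ?_
  rw [taylorCoeffZero_canonG]
  split_ifs with hn
  · simp [hn, taylorCoeffZero, h0]
  · ring

/-! ### Wirtinger derivatives and harmonicity of `P + conj Q`. -/

lemma wirtinger_harmonicMap {P Q f : ℂ → ℂ} {p q z : ℂ} (hf : f =ᶠ[nhds z] harmonicMap P Q)
    (hP : HasDerivAt P p z) (hQ : HasDerivAt Q q z) :
    wirtingerDz f z = p ∧ wirtingerDzbar f z = conj q := by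
  have h : HasFDerivAt f _ z :=
    (hP.complexToReal_fderiv.add (Complex.conjCLE.toContinuousLinearMap.hasFDerivAt.comp z
      hQ.complexToReal_fderiv)).congr_of_eventuallyEq hf
  rw [wirtingerDz, wirtingerDzbar, h.fderiv]
  simp only [add_apply, ContinuousLinearMap.comp_apply,
    smul_apply, ContinuousLinearEquiv.coe_coe, Complex.conjCLE_apply,
    one_apply_eq_self, smul_eq_mul, map_mul, Complex.conj_I, map_one]
  constructor
  · linear_combination (-p / 2 + conj q / 2) * Complex.I_sq
  · linear_combination (p / 2 - conj q / 2) * Complex.I_sq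

lemma harmonicOnNhd_harmonicMap {P Q f : ℂ → ℂ} {U : Set ℂ} (hU : IsOpen U)
    (hf : Set.EqOn f (harmonicMap P Q) U) (hP : DifferentiableOn ℂ P U)
    (hQ : DifferentiableOn ℂ Q U) : InnerProductSpace.HarmonicOnNhd f U := by
  intro z hz
  have h1 := (hP.analyticAt (hU.mem_nhds hz)).harmonicAt.add
    (hQ.analyticAt (hU.mem_nhds hz)).harmonicAt_conj
  refine (InnerProductSpace.harmonicAt_congr_nhds ?_).2 h1
  filter_upwards [hU.mem_nhds hz] with w hw
  exact hf hw

/-! ### The Cayley transform and the quadratic estimate. -/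

/-- The Cayley transform of the unit disk onto the right half-plane. -/
noncomputable def cayley (z : ℂ) : ℂ := (1 + z) / (1 - z)

lemma cayley_re_pos {z : ℂ} (hz : z ∈ unitDisk) : 0 < (cayley z).re := by
  have h1 : 0 < Complex.normSq (1 - z) := Complex.normSq_pos.2 (one_sub_ne_zero hz)
  have h2 : Complex.normSq z < 1 := by
    rw [Complex.normSq_eq_norm_sq]
    exact pow_lt_one₀ (norm_nonneg z) (mem_unitDisk.1 hz) two_ne_zero
  have e : (cayley z).re = (1 - Complex.normSq z) / Complex.normSq (1 - z) := by
    rw [cayley, Complex.div_re, ← add_div]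
    congr 1
    simp [Complex.normSq_apply]
    ring
  rw [e]
  exact div_pos (by linarith) h1

lemma cayley_inj {z w : ℂ} (hz : z ∈ unitDisk) (hw : w ∈ unitDisk) (h : cayley z = cayley w) :
    z = w := by
  have h1 := one_sub_ne_zero hz
  have h2 := one_sub_ne_zero hw
  rw [cayley, cayley, div_eq_div_iff h1 h2] at h
  linear_combination h / 2

lemma exists_cayley_eq {ζ : ℂ} (hζ : 0 < ζ.re) : ∃ z ∈ unitDisk, cayley z = ζ := by
  have h1 : ζ + 1 ≠ 0 := fun h => by
    have := congrArg Complex.re h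
    simp at this
    linarith
  refine ⟨(ζ - 1) / (ζ + 1), ?_, ?_⟩
  · rw [mem_unitDisk, norm_div, div_lt_one (norm_pos_iff.2 h1),
      ← sq_lt_sq₀ (norm_nonneg _) (norm_nonneg _), ← Complex.normSq_eq_norm_sq,
      ← Complex.normSq_eq_norm_sq]
    simp only [Complex.normSq_apply, Complex.sub_re, Complex.sub_im, Complex.add_re,
      Complex.add_im, Complex.one_re, Complex.one_im]
    nlinarith
  · have h2 : 1 - (ζ - 1) / (ζ + 1) ≠ 0 := by
      rw [one_sub_div h1]
      exact div_ne_zero (by ring_nf; norm_num) h1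
    rw [cayley, div_eq_iff h2]
    field_simp
    ring

lemma hasDerivAt_log_cayley {z : ℂ} (hz : z ∈ unitDisk) :
    HasDerivAt (fun z => Complex.log (cayley z)) (2 / ((1 + z) * (1 - z))) z := by
  have h1 := one_sub_ne_zero hz
  have h2 := one_add_ne_zero hz
  have hd : HasDerivAt cayley _ z :=
    ((hasDerivAt_id z).const_add 1).div ((hasDerivAt_id z).const_sub 1) h1
  refine (hd.clog (Or.inl (cayley_re_pos hz))).congr_deriv ?_
  simp only [cayley, id]
  field_simp
  ring

/-- The quadratic `2z² + bz + d` is smaller in the unit disk than its reciprocal polynomial when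
both its zeros lie in the disk. -/
lemma norm_quadratic_lt {b d : ℝ} (hd : d < 2) (hb : |b| < 2 + d) {z : ℂ}
    (hz : z ∈ unitDisk) :
    ‖2 * z ^ 2 + b * z + d‖ < ‖2 + b * z + d * z ^ 2‖ := by
  rw [← sq_lt_sq₀ (norm_nonneg _) (norm_nonneg _), ← Complex.normSq_eq_norm_sq,
    ← Complex.normSq_eq_norm_sq, ← sub_pos]
  have hn : z.re ^ 2 + z.im ^ 2 < 1 := by
    have := pow_lt_one₀ (norm_nonneg z) (mem_unitDisk.1 hz) two_ne_zero
    rw [← Complex.normSq_eq_norm_sq, Complex.normSq_apply] at this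
    linarith
  have e : Complex.normSq (2 + b * z + d * z ^ 2) - Complex.normSq (2 * z ^ 2 + b * z + d) =
      (1 - (z.re ^ 2 + z.im ^ 2)) * ((2 - d) *
        ((2 + d) * (1 + (z.re ^ 2 + z.im ^ 2)) + 2 * b * z.re)) := by
    simp [Complex.normSq_apply, pow_two]
    ring
  rw [e]
  obtain ⟨hb1, hb2⟩ := abs_lt.1 hb
  have h : 0 < (2 + d) * (1 + (z.re ^ 2 + z.im ^ 2)) + 2 * b * z.re := by
    have h3 : 0 ≤ (2 + d) * z.im ^ 2 := mul_nonneg (by linarith) (sq_nonneg _)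
    have hx : z.re ^ 2 < 1 := by nlinarith [sq_nonneg z.im]
    obtain ⟨hx1, hx2⟩ := abs_lt.1 ((sq_lt_one_iff_abs_lt_one _).1 hx)
    -- With `x = z.re`, `2((2+d)(1+x²) + 2bx) = (2+d+b)(1+x)² + (2+d-b)(1-x)²`.
    nlinarith [mul_pos (sub_pos.2 hb1) (pow_pos (sub_pos.2 hx1) 2),
      mul_pos (sub_pos.2 hb2) (pow_pos (sub_pos.2 hx2) 2)]
  exact mul_pos (by linarith) (mul_pos (by linarith) h)

/-! ### Derivatives determined by the shear, and the dilatation bound. -/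

section HalfPlaneShear

variable {a : ℝ} {h g : ℂ → ℂ}

lemma one_add_ofReal_ne_zero (ha : -1 < a) : 1 + (a : ℂ) ≠ 0 := by
  norm_cast
  linarith

lemma one_add_mul_ne_zero (ha : -1 < a) (ha' : a < 1) {z : ℂ} (hz : z ∈ unitDisk) :
    1 + (a : ℂ) * z ≠ 0 := by
  refine one_add_ne_zero (mem_unitDisk.2 ?_)
  rw [norm_mul, Complex.norm_real, Real.norm_eq_abs]
  exact mul_lt_one_of_nonneg_of_lt_one_left (abs_nonneg a) (abs_lt.2 ⟨ha, ha'⟩)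
    (mem_unitDisk.1 hz).le

lemma deriv_of_shear (ha : -1 < a) (ha' : a < 1)
    (hh : DifferentiableOn ℂ h unitDisk) (hg : DifferentiableOn ℂ g unitDisk)
    (hf : IsUnivalentHarmonic (harmonicMap h g))
    (hsum : ∀ z ∈ unitDisk, h z + g z = z / (1 - z))
    (hdil : ∀ z ∈ unitDisk, dilatation h g z = (z + (a : ℂ)) / (1 + (a : ℂ) * z))
    {z : ℂ} (hz : z ∈ unitDisk) :
    deriv h z = (1 + a * z) / ((1 + a) * ((1 + z) * (1 - z) ^ 2)) ∧
      deriv g z = (z + a) / ((1 + a) * ((1 + z) * (1 - z) ^ 2)) := by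
  have n1 := one_sub_ne_zero hz
  have n2 := one_add_ne_zero hz
  have n3 := one_add_mul_ne_zero ha ha' hz
  have n4 := one_add_ofReal_ne_zero ha
  have dh := (hh.differentiableAt (isOpen_unitDisk.mem_nhds hz)).hasDerivAt
  have dg := (hg.differentiableAt (isOpen_unitDisk.mem_nhds hz)).hasDerivAt
  obtain ⟨w1, w2⟩ := wirtinger_harmonicMap (f := harmonicMap h g) (.refl _ _) dh dg
  -- Needed to clear the quotient `g'/h'`, which would be `0` by convention if `h'` vanished.
  have hne : deriv h z ≠ 0 := by
    have := hf.sensePreserving z hz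
    rw [w1] at this
    exact norm_pos_iff.1 ((norm_nonneg _).trans_lt this)
  have hs : deriv h z + deriv g z = 1 / (1 - z) ^ 2 := by
    have h1 : HasDerivAt (fun z => h z + g z) (1 / (1 - z) ^ 2) z := by
      have : HasDerivAt (fun z : ℂ => z / (1 - z)) _ z :=
        (hasDerivAt_id z).div ((hasDerivAt_id z).const_sub 1) n1
      refine (this.congr_of_eventuallyEq ?_).congr_deriv ?_
      · filter_upwards [isOpen_unitDisk.mem_nhds hz] with w hw using hsum w hw
      · simp only [id]
        congr 1
        ring
    exact (dh.add dg).unique h1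
  have hd := hdil z hz
  rw [dilatation, div_eq_div_iff hne n3] at hd
  rw [eq_div_iff (pow_ne_zero 2 n1)] at hs
  have key : deriv h z * ((1 + a) * ((1 + z) * (1 - z) ^ 2)) = 1 + a * z := by
    linear_combination (1 + a * z) * hs - (1 - z) ^ 2 * hd
  have hD : (1 + (a : ℂ)) * ((1 + z) * (1 - z) ^ 2) ≠ 0 := by positivity
  refine ⟨(eq_div_iff hD).2 key, (eq_div_iff hD).2 ?_⟩
  linear_combination (1 + a) * (1 + z) * hs - key

lemma hasDerivAt_shear_factor {p q : ℂ} {z : ℂ} (ha : -1 < a) (hz : z ∈ unitDisk) :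
    HasDerivAt (fun z : ℂ => (p + q * z) / ((1 + (a : ℂ)) * ((1 + z) * (1 - z) ^ 2)))
      ((q * ((1 + z) * (1 - z)) + (p + q * z) * (1 + 3 * z)) /
        ((1 + a) * ((1 + z) ^ 2 * (1 - z) ^ 3))) z := by
  have n1 := one_sub_ne_zero hz
  have n2 := one_add_ne_zero hz
  have n4 := one_add_ofReal_ne_zero ha
  have h1 : HasDerivAt (fun z : ℂ => p + q * z) q z := by
    simpa using ((hasDerivAt_id z).const_mul q).const_add p
  have h2 : HasDerivAt (fun z : ℂ => (1 + (a : ℂ)) * ((1 + z) * (1 - z) ^ 2)) _ z :=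
    ((((hasDerivAt_id z).const_add 1).mul (((hasDerivAt_id z).const_sub 1).pow 2)).const_mul
      (1 + (a : ℂ)))
  refine (h1.div h2 (by positivity)).congr_deriv ?_
  simp only [id, Pi.pow_apply, Nat.cast_ofNat]
  field_simp
  ring

lemma norm_shear_quotient_lt (ha : -1 < a) (ha' : a < 1) {z : ℂ} (hz : z ∈ unitDisk) :
    ‖-(z * (2 * z ^ 2 + (1 + 3 * a) * z + (1 + a))) /
        (2 * ((1 + a) * ((1 + z) ^ 2 * (1 - z) ^ 3)))‖ <
      ‖(2 + (1 + 3 * a) * z + (1 + a) * z ^ 2) /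
        (2 * ((1 + a) * ((1 + z) ^ 2 * (1 - z) ^ 3)))‖ := by
  have n1 := one_sub_ne_zero hz
  have n2 := one_add_ne_zero hz
  have n4 := one_add_ofReal_ne_zero ha
  rw [norm_div, norm_div, norm_neg, norm_mul]
  -- The conditions `d < 2` and `|b| < 2 + d` amount exactly to `-1 < a < 1`.
  have key := norm_quadratic_lt (b := 1 + 3 * a) (d := 1 + a) (by linarith)
    (abs_lt.2 ⟨by linarith, by linarith⟩) hz
  push_cast at key
  have hD : 0 < ‖2 * ((1 + (a : ℂ)) * ((1 + z) ^ 2 * (1 - z) ^ 3))‖ :=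
    norm_pos_iff.2 (mul_ne_zero two_ne_zero (by positivity))
  refine div_lt_div_of_pos_right (lt_of_le_of_lt ?_ key) hD
  exact mul_le_of_le_one_left (norm_nonneg _) (mem_unitDisk.1 hz).le

end HalfPlaneShear

/-! ### The main theorem. -/

theorem theorem4 (a : ℝ) (ha : -1 < a) (ha' : a < 1) (h g : ℂ → ℂ)
    (hh : DifferentiableOn ℂ h unitDisk) (hg : DifferentiableOn ℂ g unitDisk)
    (h_zero : h 0 = 0) (g_zero : g 0 = 0)
    (hf : IsUnivalentHarmonic (harmonicMap h g))
    (hconv : Convex ℝ (harmonicMap h g '' unitDisk))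
    (hsum : ∀ z ∈ unitDisk, h z + g z = z / (1 - z))
    (hdil : ∀ z ∈ unitDisk, dilatation h g z = (z + (a : ℂ)) / (1 + (a : ℂ) * z)) :
    IsSHO (fun z => (1 + (a : ℂ)) * harmonicConvolution canonH canonG h g z) ∧
      ConvexInRealDirection (harmonicConvolution canonH canonG h g '' unitDisk) ∧
      (IsKHO (harmonicMap h g) → IsSHO (harmonicConvolution canonH canonG h g)) := by
  have hd := fun z (hz : z ∈ unitDisk) => deriv_of_shear ha ha' hh hg hf hsum hdil hz
  have n4 := one_add_ofReal_ne_zero ha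
  have mem0 : (0 : ℂ) ∈ unitDisk := mem_unitDisk.2 (by simp)
  set F := harmonicConvolution canonH canonG h g with hF
  set P : ℂ → ℂ := fun z => (h z + z * deriv h z) / 2 with hP
  set Q : ℂ → ℂ := fun z => (g z - z * deriv g z) / 2 with hQ
  have hFPQ : ∀ z ∈ unitDisk, F z = P z + conj (Q z) := fun z hz => by
    rw [hF, harmonicConvolution, harmonicMap, analyticConvolution_canonH hh h_zero hz,
      analyticConvolution_canonG hg g_zero hz]
  have dP : ∀ z ∈ unitDisk, HasDerivAt P ((2 + (1 + 3 * a) * z + (1 + a) * z ^ 2) /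
      (2 * ((1 + a) * ((1 + z) ^ 2 * (1 - z) ^ 3)))) z := fun z hz => by
    have n1 := one_sub_ne_zero hz
    have n2 := one_add_ne_zero hz
    have d1 := (hh.differentiableAt (isOpen_unitDisk.mem_nhds hz)).hasDerivAt
    have d2 : HasDerivAt (deriv h) _ z :=
      (hasDerivAt_shear_factor (p := 1) (q := a) ha hz).congr_of_eventuallyEq (by
        filter_upwards [isOpen_unitDisk.mem_nhds hz] with w hw using (hd w hw).1)
    refine ((d1.add ((hasDerivAt_id z).mul d2)).div_const 2).congr_deriv ?_
    simp only [id, (hd z hz).1]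
    field_simp
    ring
  have dQ : ∀ z ∈ unitDisk, HasDerivAt Q (-(z * (2 * z ^ 2 + (1 + 3 * a) * z + (1 + a))) /
      (2 * ((1 + a) * ((1 + z) ^ 2 * (1 - z) ^ 3)))) z := fun z hz => by
    have n1 := one_sub_ne_zero hz
    have n2 := one_add_ne_zero hz
    have d1 := (hg.differentiableAt (isOpen_unitDisk.mem_nhds hz)).hasDerivAt
    have d2 : HasDerivAt (deriv g) _ z :=
      (hasDerivAt_shear_factor (p := a) (q := 1) ha hz).congr_of_eventuallyEq (by
        filter_upwards [isOpen_unitDisk.mem_nhds hz] with w hw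
        rw [(hd w hw).2, one_mul, add_comm])
    refine ((d1.sub ((hasDerivAt_id z).mul d2)).div_const 2).congr_deriv ?_
    simp only [id, (hd z hz).2]
    field_simp
    ring
  -- This constant comes from `(1-ω)/(1+ω) = c(1-z)/(1+z)`.
  have hc : 0 < (1 - a) / (1 + a) := div_pos (by linarith) (by linarith)
  set c : ℝ := (1 - a) / (1 + a) with hcdef
  have hcc : (c : ℂ) = (1 - a) / (1 + a) := by rw [hcdef]; push_cast; rfl
  have hdiff : ∀ z ∈ unitDisk, deriv h z - deriv g z = c / ((1 + z) * (1 - z)) := fun z hz => by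
    have n1 := one_sub_ne_zero hz
    have n2 := one_add_ne_zero hz
    rw [(hd z hz).1, (hd z hz).2, hcc]
    field_simp
    ring
  have hlog : ∀ z ∈ unitDisk, h z - g z = c / 2 * Complex.log (cayley z) := by
    refine isOpen_unitDisk.eqOn_of_deriv_eq (convex_ball _ _).isPreconnected (hh.sub hg)
      (fun z hz => ((hasDerivAt_log_cayley hz).const_mul
        (c / 2 : ℂ)).differentiableAt.differentiableWithinAt) (fun z hz => ?_) mem0 ?_
    · have d1 := (hh.differentiableAt (isOpen_unitDisk.mem_nhds hz)).hasDerivAt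
      have d2 := (hg.differentiableAt (isOpen_unitDisk.mem_nhds hz)).hasDerivAt
      refine (d1.sub d2).deriv.trans ?_
      rw [((hasDerivAt_log_cayley hz).const_mul (c / 2 : ℂ)).deriv, hdiff z hz]
      ring
    · simp [h_zero, g_zero, cayley]
  have hre : ∀ z ∈ unitDisk,
      (F z).re = (shearRe c ‖cayley z‖ (cayley z).arg - 1) / 4 := fun z hz => by
    have n1 := one_sub_ne_zero hz
    have n2 := one_add_ne_zero hz
    have e : P z + Q z =
        (((1 + c / 2 : ℝ) : ℂ) * cayley z - ((c / 2 : ℝ) : ℂ) * (cayley z)⁻¹ - 1) / 4 := by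
      have : P z + Q z = ((h z + g z) + z * (deriv h z - deriv g z)) / 2 := by
        simp only [hP, hQ]; ring
      rw [this, hsum z hz, hdiff z hz, cayley]
      push_cast
      field_simp
      ring
    have hn : 0 < ‖cayley z‖ := norm_pos_iff.2 (div_ne_zero n2 n1)
    have : (F z).re = (P z + Q z).re := by simp [hFPQ z hz]
    rw [this, e, shearRe]
    have e2 : (4 : ℂ) = ((4 : ℝ) : ℂ) := by norm_num
    rw [e2, Complex.div_ofReal_re, Complex.sub_re, Complex.sub_re, Complex.re_ofReal_mul,
      Complex.re_ofReal_mul, Complex.inv_re, Complex.normSq_eq_norm_sq, Complex.one_re,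
      ← Complex.norm_mul_cos_arg (cayley z)]
    field_simp
  have him : ∀ z ∈ unitDisk,
      (F z).im = shearIm c ‖cayley z‖ (cayley z).arg / 8 := fun z hz => by
    have n1 := one_sub_ne_zero hz
    have n2 := one_add_ne_zero hz
    have e : P z - Q z =
        (((2 * c : ℝ) : ℂ) * Complex.log (cayley z) + cayley z ^ 2 - 1) / (8 : ℝ) := by
      have : P z - Q z = ((h z - g z) + z * (deriv h z + deriv g z)) / 2 := by
        simp only [hP, hQ]; ring
      rw [this, hlog z hz, (hd z hz).1, (hd z hz).2]
      have : cayley z ^ 2 = 1 + 4 * (z / (1 - z) ^ 2) := by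
        rw [cayley]
        field_simp
        ring
      rw [this]
      push_cast
      field_simp
      ring
    have : (F z).im = (P z - Q z).im := by simp [hFPQ z hz]; ring
    rw [this, e, shearIm, Complex.div_ofReal_im, Complex.sub_im, Complex.add_im,
      Complex.im_ofReal_mul, Complex.log_im, pow_two, Complex.mul_im, Complex.one_im,
      Real.sin_two_mul]
    rw [← Complex.norm_mul_cos_arg (cayley z), ← Complex.norm_mul_sin_arg (cayley z)]
    ring
  obtain ⟨hinj, hcr⟩ := injOn_and_convexInRealDirection hc (S := unitDisk) (F := F)
    (r := fun z => ‖cayley z‖) (s := fun z => (cayley z).arg)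
    (fun z hz => norm_pos_iff.2 fun h0 => by
      have := cayley_re_pos hz
      simp [h0] at this)
    (fun z hz => Complex.abs_arg_lt_pi_div_two_iff.2 (Or.inl (cayley_re_pos hz)))
    (fun z hz w hw h1 h2 => cayley_inj hz hw (Complex.ext_norm_arg h1 h2))
    (fun ρ q hρ hq => by
      obtain ⟨q1, q2⟩ := abs_lt.1 hq
      obtain ⟨z, hz, hzc⟩ := exists_cayley_eq
        (ζ := ρ * (Complex.cos q + Complex.sin q * Complex.I)) (by
          rw [Complex.re_ofReal_mul, ← Complex.ofReal_cos, ← Complex.ofReal_sin, Complex.add_re,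
            Complex.ofReal_re, Complex.re_ofReal_mul, Complex.I_re, mul_zero, add_zero]
          exact mul_pos hρ (Real.cos_pos_of_mem_Ioo ⟨by linarith, q2⟩))
      refine ⟨z, hz, ?_, ?_⟩
      · simp only [hzc]
        rw [norm_mul, Complex.norm_cos_add_sin_mul_I, Complex.norm_real, Real.norm_eq_abs,
          abs_of_pos hρ, mul_one]
      · simp only [hzc]
        exact Complex.arg_mul_cos_add_sin_mul_I hρ ⟨by linarith, by linarith⟩)
    hre him
  have hEq : Set.EqOn (fun z => (1 + (a : ℂ)) * F z)
      (harmonicMap (fun z => (1 + (a : ℂ)) * P z) (fun z => (1 + (a : ℂ)) * Q z)) unitDisk :=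
    fun z hz => by simp [harmonicMap, hFPQ z hz, mul_add]
  have hW := fun z (hz : z ∈ unitDisk) =>
    wirtinger_harmonicMap (hEq.eventuallyEq_of_mem (isOpen_unitDisk.mem_nhds hz))
      ((dP z hz).const_mul _) ((dQ z hz).const_mul _)
  have main : IsSHO (fun z => (1 + (a : ℂ)) * F z) :=
    { harmonic := harmonicOnNhd_harmonicMap isOpen_unitDisk hEq
        (fun z hz => ((dP z hz).const_mul _).differentiableAt.differentiableWithinAt)
        (fun z hz => ((dQ z hz).const_mul _).differentiableAt.differentiableWithinAt)
      sensePreserving := fun z hz => by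
        rw [(hW z hz).1, (hW z hz).2, Complex.norm_conj, norm_mul, norm_mul]
        exact mul_lt_mul_of_pos_left (norm_shear_quotient_lt ha ha' hz) (norm_pos_iff.2 n4)
      univalent := fun z hz w hw hzw => hinj hz hw (mul_left_cancel₀ n4 hzw)
      map_zero := by simp [hFPQ 0 mem0, hP, hQ, h_zero, g_zero]
      dz_zero := by
        rw [(hW 0 mem0).1]
        field_simp
        simp
      dzbar_zero := by
        rw [(hW 0 mem0).2]
        simp }
  refine ⟨main, hcr, fun hK => ?_⟩
  have d1 := (hh.differentiableAt (isOpen_unitDisk.mem_nhds mem0)).hasDerivAt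
  have d2 := (hg.differentiableAt (isOpen_unitDisk.mem_nhds mem0)).hasDerivAt
  -- The normalization forces `g'(0) = a/(1+a) = 0`, so `a = 0` and the factor `1 + a` disappears.
  have h0 := hK.dzbar_zero
  rw [(wirtinger_harmonicMap (f := harmonicMap h g) (.refl _ _) d1 d2).2, (hd 0 mem0).2] at h0
  have ha0 : a = 0 := by simpa [n4] using h0
  simpa [ha0] using main
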